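/- **Setting.** Unit $0$ is treated and units $1,2,\dots$ are potential controls. Let $\epsilon_{it}$ ($i\in\{0,1,2,\dots\}$, $t\in\mathbb Z$) be real random variables on one probability space, let $\boldsymbol\lambda_t\in\mathbb R^{1\times F}$ (common factors) and $\boldsymbol\mu_i\in\mathbb R^{F}$ (factor loadings) be nonrandom, and let the treatment effects $\alpha_{it}$ be arbitrary. Potential outcomes are $$y^N_{it}=\boldsymbol\lambda_t\boldsymbol\mu_i+\epsilon_{it},\qquad y^I_{it}=\alpha_{it}+y^N_{it},$$ and the observed outcome is $y_{it}=d_{it}y^I_{it}+(1-d_{it})y^N_{it}$, where $d_{it}=1$ if $i=0$ and $t>0$, and $d_{it}=0$ otherwise. For each $T_0$ one observes units $0,1,\dots,J$ in periods $-T_0+1,\dots,0,1,\dots,T_1$, where $J=J(T_0)\ge 1$ is a function of $T_0$ and $T_1$ is fixed. Put $\mathcal T_0=\{-T_0+1,\dots,0\}$, $\mathbf y_t=(y_{1t},\dots,y_{Jt})'$, $\Delta^{J-1}=\{\mathbf w\in\mathbb R^J: w_j\ge0,\ \sum_j w_j=1\}$, and let $\mathbf M_J$ be the $J\times F$ matrix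 with rows $\boldsymbol\mu_1',\dots,\boldsymbol\mu_J'$. Let $$\widehat{\mathbf w}_{SC}\in\operatorname*{argmin}_{\mathbf w\in\Delta^{J-1}}\ \frac1{T_0}\sum_{t\in\mathcal T_0}(y_{0t}-\mathbf w'\mathbf y_t)^2$$ be any choice of minimizer, and $\widehat{\boldsymbol\mu}_{SC}=\mathbf M_J'\widehat{\mathbf w}_{SC}$. **Assumptions** (limits and $o_p(1)$ are as $T_0\to\infty$). 1. (Shocks) For all $i\ge 0$ and $t\le T_1$: (a) $\mathbb E[\epsilon_{it}]=0$; (b) the processes $\{\epsilon_{it}\}_{t\le T_1}$ are independent across $i$; (c) for each $J=J(T_0)$ the vector process $(\epsilon_{0t},\dots,\epsilon_{Jt})_{t\le0}$ is $\alpha$-mixing, i.e. $\sup_t\sup\{|P(A\cap B)-P(A)P(B)|\}\to0$ as $k\to\infty$, where $A$ ranges over the events generated by the vectors at times $\le t$ and $B$ over those generated by the vectors at times in $[t+k,0]$; (d) $\sup_{i,\,t\le T_1}\mathbb E[\epsilon_{it}^4]<\infty$ and $\frac1{T_0}\sum_{t\in\mathcal T_0}\mathbb E[\epsilon_{0t}^2]\to\sigma_0^2$;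 (e) there is $\underline\gamma>0$ with $\mathbb E[\epsilon_{it}^2]\ge\underline\gamma$ for all $i\ge 0$ and $t\le T_1$. 2. (Loadings) (a) There are $\mathbf w^*_J\in\Delta^{J-1}$ (one for each $T_0$, with $J=J(T_0)$) such that $\|\mathbf M_J'\mathbf w^*_J-\boldsymbol\mu_0\|_2\to0$ and $\|\mathbf w^*_J\|_2\to0$ (which forces $J\to\infty$); (b) $\sup_i\|\boldsymbol\mu_i\|_2<\infty$. 3. (Factors) $\frac1{T_0}\sum_{t\in\mathcal T_0}\boldsymbol\lambda_t'\boldsymbol\lambda_t\to\boldsymbol\Omega$ for some positive definite $\boldsymbol\Omega$. 4. (High-level conditions) (a) $\max_{1\le j\le J}\left|\frac1{T_0}\sum_{t\in\mathcal T_0}\epsilon_{0t}\epsilon_{jt}\right|=o_p(1)$ and, for each $f=1,\dots,F$, $\max_{0\le j\le J}\left|\frac1{T_0}\sum_{t\in\mathcal T_0}\lambda_{ft}\epsilon_{jt}\right|=o_p(1)$; (b) there is $c>0$ such that $\min_{1\le j\le J}\sum_{t\in\mathcal T_0}\epsilon_{jt}^2\ge cT_0$ with probability $1-o(1)$, and $\max_{1\le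 i,j\le J,\ i\ne j}\left|\frac1{T_0}\sum_{t\in\mathcal T_0}\epsilon_{it}\epsilon_{jt}\right|=o_p(1)$. **Proposition.** Under Assumptions 1, 2, 3 and 4(a), as $T_0\to\infty$, (i) $\widehat{\boldsymbol\mu}_{SC}\xrightarrow{p}\boldsymbol\mu_0$; (ii) $\frac1{T_0}\sum_{t\in\mathcal T_0}\left(y_{0t}-\widehat{\mathbf w}_{SC}'\mathbf y_t\right)^2\xrightarrow{p}\sigma_0^2$. If in addition Assumption 4(b) holds, then (iii) $\|\widehat{\mathbf w}_{SC}\|_2\xrightarrow{p}0$. -/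

import Mathlib

open Filter Topology MeasureTheory ProbabilityTheory
open scoped ENNReal Matrix

namespace SyntheticControl

noncomputable section

/-! ### Strong mixing -/

/-- The strong mixing (`α`) coefficient of two σ-algebras:
`sup |P(A ∩ B) - P(A) P(B)|` over `A ∈ m₁` and `B ∈ m₂`. -/
def alphaCoeff {Ω : Type*} [MeasurableSpace Ω] (P : Measure Ω) (m₁ m₂ : MeasurableSpace Ω) :
    ℝ≥0∞ :=
  ⨆ (A : Set Ω) (B : Set Ω) (_ : MeasurableSet[m₁] A) (_ : MeasurableSet[m₂] B),
    ENNReal.ofReal |P.real (A ∩ B) - P.real A * P.real B|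

/-- The σ-algebra generated by the variables `X s` with `s ∈ S`. -/
abbrev sigmaGen {Ω E : Type*} [MeasurableSpace E] (X : ℤ → Ω → E) (S : Set ℤ) :
    MeasurableSpace Ω :=
  ⨆ s ∈ S, MeasurableSpace.comap (X s) inferInstance

/-- The `k`-th strong mixing coefficient of the process `X` observed at the times in `S`:
the supremum over `t` of the coefficient between the past `s ≤ t` and the future `s ≥ t + k`. -/
def mixingCoeff {Ω E : Type*} [MeasurableSpace Ω] [MeasurableSpace E] (P : Measure Ω)
    (X : ℤ → Ω → E) (S : Set ℤ) (k : ℕ) : ℝ≥0∞ :=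
  ⨆ t : ℤ, alphaCoeff P (sigmaGen X {s | s ∈ S ∧ s ≤ t}) (sigmaGen X {s | s ∈ S ∧ t + k ≤ s})

/-- `X`, observed at the times in `S`, is `α`-mixing. -/
def IsAlphaMixing {Ω E : Type*} [MeasurableSpace Ω] [MeasurableSpace E] (P : Measure Ω)
    (X : ℤ → Ω → E) (S : Set ℤ) : Prop :=
  Tendsto (mixingCoeff P X S) atTop (𝓝 0)

/-! ### The linear factor model and the synthetic control estimator

Units are `0` (treated) and `1, 2, …` (controls); with `J` controls, control `j + 1` is indexed
by `j : Fin J`. Time runs over `ℤ`. -/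

/-- The pre-treatment periods `-T₀ + 1, …, -1, 0`. -/
def prePeriods (T₀ : ℕ) : Finset ℤ := Finset.Ioc (-(T₀ : ℤ)) 0

/-- The pre-treatment average `T₀⁻¹ ∑ x t`. -/
def preMean (T₀ : ℕ) (x : ℤ → ℝ) : ℝ := (T₀ : ℝ)⁻¹ * ∑ t ∈ prePeriods T₀, x t

/-- Potential outcome without treatment, `λ_t μ_i + ε_{it}`. -/
def outcomeN {Ω : Type*} {F : ℕ} (lam : ℤ → Fin F → ℝ) (mu : ℕ → Fin F → ℝ)
    (eps : ℕ → ℤ → Ω → ℝ) (i : ℕ) (t : ℤ) (ω : Ω) : ℝ :=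
  lam t ⬝ᵥ mu i + eps i t ω

/-- Potential outcome with treatment, `α_{it} + y^N_{it}`. -/
def outcomeI {Ω : Type*} {F : ℕ} (lam : ℤ → Fin F → ℝ) (mu : ℕ → Fin F → ℝ)
    (eps : ℕ → ℤ → Ω → ℝ) (eff : ℕ → ℤ → Ω → ℝ) (i : ℕ) (t : ℤ) (ω : Ω) : ℝ :=
  eff i t ω + outcomeN lam mu eps i t ω

/-- Treatment indicator: only unit `0` is treated, and only after period `0`. -/
def treat (i : ℕ) (t : ℤ) : ℝ := if i = 0 ∧ 0 < t then 1 else 0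

/-- Observed outcome `d_{it} y^I_{it} + (1 - d_{it}) y^N_{it}`. -/
def outcome {Ω : Type*} {F : ℕ} (lam : ℤ → Fin F → ℝ) (mu : ℕ → Fin F → ℝ)
    (eps : ℕ → ℤ → Ω → ℝ) (eff : ℕ → ℤ → Ω → ℝ) (i : ℕ) (t : ℤ) (ω : Ω) : ℝ :=
  treat i t * outcomeI lam mu eps eff i t ω + (1 - treat i t) * outcomeN lam mu eps i t ω

/-- The `J × F` matrix `M_J` whose rows are the factor loadings of the controls. -/
def loadingMatrix {F : ℕ} (mu : ℕ → Fin F → ℝ) (J : ℕ) : Matrix (Fin J) (Fin F) ℝ :=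
  Matrix.of fun j f => mu (j + 1) f

/-- Pre-treatment mean squared fit of the weights `w` for realized outcomes `y`. -/
def preFit (y : ℕ → ℤ → ℝ) (T₀ J : ℕ) (w : Fin J → ℝ) : ℝ :=
  preMean T₀ fun t => (y 0 t - ∑ j : Fin J, w j * y (j + 1) t) ^ 2

/-- `w` minimizes the pre-treatment mean squared fit over the simplex. -/
def IsSCWeights (y : ℕ → ℤ → ℝ) (T₀ J : ℕ) (w : Fin J → ℝ) : Prop :=
  w ∈ stdSimplex ℝ (Fin J) ∧ IsMinOn (preFit y T₀ J) (stdSimplex ℝ (Fin J)) w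

/-- Euclidean norm of a vector. -/
def norm2 {n : ℕ} (v : Fin n → ℝ) : ℝ := ‖WithLp.toLp 2 v‖

/-! ### Assumptions -/

/-- Assumption on the idiosyncratic shocks. `T₁` is the last period, `J T₀` the number of
controls when there are `T₀` pre-treatment periods. -/
structure ShockAssumption {Ω : Type*} [MeasurableSpace Ω] (P : Measure Ω)
    (eps : ℕ → ℤ → Ω → ℝ) (T₁ : ℕ) (J : ℕ → ℕ) (σ₀ : ℝ) : Prop where
  measurable : ∀ i t, t ≤ (T₁ : ℤ) → Measurable (eps i t)
  mean_zero : ∀ i t, t ≤ (T₁ : ℤ) → ∫ ω, eps i t ω ∂P = 0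
  indep : iIndepFun (fun (i : ℕ) (ω : Ω) (t : {t : ℤ // t ≤ (T₁ : ℤ)}) => eps i t ω) P
  mixing : ∀ T₀ : ℕ,
    IsAlphaMixing P (fun (t : ℤ) (ω : Ω) (i : Fin (J T₀ + 1)) => eps i t ω) (Set.Iic 0)
  fourth_moment : ∃ C : ℝ, ∀ i t, t ≤ (T₁ : ℤ) →
    Integrable (fun ω => eps i t ω ^ 4) P ∧ ∫ ω, eps i t ω ^ 4 ∂P ≤ C
  variance_limit :
    Tendsto (fun T₀ : ℕ => preMean T₀ fun t => ∫ ω, eps 0 t ω ^ 2 ∂P) atTop (𝓝 (σ₀ ^ 2))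
  variance_lower : ∃ γ : ℝ, 0 < γ ∧ ∀ i t, t ≤ (T₁ : ℤ) → γ ≤ ∫ ω, eps i t ω ^ 2 ∂P

/-- Assumption on the factor loadings: diluted simplex weights asymptotically reconstruct the
loadings of unit `0`, and the loadings are uniformly bounded. -/
structure LoadingAssumption {F : ℕ} (mu : ℕ → Fin F → ℝ) (J : ℕ → ℕ) : Prop where
  diluted : ∃ w : (T₀ : ℕ) → Fin (J T₀) → ℝ,
    (∀ T₀, w T₀ ∈ stdSimplex ℝ (Fin (J T₀))) ∧
    Tendsto (fun T₀ => norm2 ((loadingMatrix mu (J T₀))ᵀ *ᵥ w T₀ - mu 0)) atTop (𝓝 0) ∧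
    Tendsto (fun T₀ => norm2 (w T₀)) atTop (𝓝 0)
  bounded : ∃ C : ℝ, ∀ i, norm2 (mu i) ≤ C

/-- Assumption on the common factors: their pre-treatment second moment matrix converges to a
positive definite matrix. -/
def FactorAssumption {F : ℕ} (lam : ℤ → Fin F → ℝ) : Prop :=
  ∃ Om : Matrix (Fin F) (Fin F) ℝ, Om.PosDef ∧
    Tendsto (fun T₀ : ℕ => (T₀ : ℝ)⁻¹ • ∑ t ∈ prePeriods T₀, Matrix.vecMulVec (lam t) (lam t))
      atTop (𝓝 Om)

/-- First part of the high-level conditions on maximal cross moments. -/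
structure CrossMomentAssumptionA {Ω : Type*} [MeasurableSpace Ω] (P : Measure Ω) {F : ℕ}
    (lam : ℤ → Fin F → ℝ) (eps : ℕ → ℤ → Ω → ℝ) (J : ℕ → ℕ) : Prop where
  treated : TendstoInMeasure P
    (fun (T₀ : ℕ) (ω : Ω) => ⨆ j : Fin (J T₀), |preMean T₀ fun t => eps 0 t ω * eps (j + 1) t ω|)
    atTop (fun _ => 0)
  factor : ∀ f : Fin F, TendstoInMeasure P
    (fun (T₀ : ℕ) (ω : Ω) => ⨆ j : Fin (J T₀ + 1), |preMean T₀ fun t => lam t f * eps j t ω|)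
    atTop (fun _ => 0)

/-- Second part of the high-level conditions, on the control units. -/
structure CrossMomentAssumptionB {Ω : Type*} [MeasurableSpace Ω] (P : Measure Ω)
    (eps : ℕ → ℤ → Ω → ℝ) (J : ℕ → ℕ) : Prop where
  lower : ∃ c : ℝ, 0 < c ∧
    Tendsto (fun T₀ : ℕ =>
      P {ω | c * T₀ ≤ ⨅ j : Fin (J T₀), ∑ t ∈ prePeriods T₀, |eps (j + 1) t ω ^ 2|})
      atTop (𝓝 1)
  cross : TendstoInMeasure P
    (fun (T₀ : ℕ) (ω : Ω) => ⨆ p : {p : Fin (J T₀) × Fin (J T₀) // p.1 ≠ p.2},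
      |preMean T₀ fun t => eps (p.1.1 + 1) t ω * eps (p.1.2 + 1) t ω|)
    atTop (fun _ => 0)

end

end SyntheticControl

/-!
The pre-treatment residual of weights `w` is `λ_t δ + ε_{0t} - w' ε_t`, with `δ = μ₀ - M_J' w` the
loading gap. Its average square is the sum of a factor part `T₀⁻¹ ∑ (λ_t δ)²`, the treated unit's
own average squared shock, and the noise `T₀⁻¹ ∑ (w' ε_t)²` of the weighted controls, plus cross
terms. Because simplex weights have `ℓ¹` norm one and the gap is bounded, the cross terms are
controlled, uniformly in `w`, by the maximal cross moments, hence vanish in probability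
(`abs_preFit_sub_le`).

The diluted weights `w*` have a vanishing gap, and independence across units bounds the expectation
of their noise by a constant times `‖w*‖²` (`ShockAssumption.tendsto_noiseFit`). Comparing the
minimizer with `w*`, the treated unit's shocks cancel, so the minimizer's factor part and noise
are both bounded by a quantity `E` tending to `0` in probability
(`IsSCWeights.factorFit_add_noiseFit_le`). Three consequences follow.

* The factor part dominates a multiple of `‖δ‖²`, as the second moment matrices converge to a
  positive definite one (`eventually_coercive`); so the loadings are recovered.
* The fit differs from `T₀⁻¹ ∑ ε_{0t}²` by a term vanishing in probability, and this average
  converges to `σ₀²` by a law of large numbers for strongly mixing variables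
  (`MeanLLN.sq_of_mixing`). The latter is proved without a covariance inequality: for indicators of
  events the mixing coefficients bound the covariances directly, and squares with bounded fourth
  moments are approximated in `L¹`, uniformly in time, by finite combinations of indicators.
* When the controls' shocks have average squares bounded below and vanishing average products, the
  noise dominates a multiple of `‖w‖²` (`norm2_sq_le_noiseFit`); so the weights are diluted.
-/

namespace SyntheticControl

/-! ### Pre-treatment averages -/

lemma mem_prePeriods {T₀ : ℕ} {t : ℤ} : t ∈ prePeriods T₀ ↔ -(T₀ : ℤ) < t ∧ t ≤ 0 := by
  simp [prePeriods]

lemma card_prePeriods (T₀ : ℕ) : (prePeriods T₀).card = T₀ := by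
  simp [prePeriods]

lemma preMean_add (T₀ : ℕ) (x y : ℤ → ℝ) :
    preMean T₀ (fun t => x t + y t) = preMean T₀ x + preMean T₀ y := by
  simp [preMean, Finset.sum_add_distrib, mul_add]

lemma preMean_const_mul (T₀ : ℕ) (c : ℝ) (x : ℤ → ℝ) :
    preMean T₀ (fun t => c * x t) = c * preMean T₀ x := by
  simp only [preMean, ← Finset.mul_sum]; ring

lemma preMean_sub (T₀ : ℕ) (x y : ℤ → ℝ) :
    preMean T₀ (fun t => x t - y t) = preMean T₀ x - preMean T₀ y := by
  simp [preMean, Finset.sum_sub_distrib, mul_sub]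

lemma preMean_sum {ι : Type*} (T₀ : ℕ) (s : Finset ι) (x : ι → ℤ → ℝ) :
    preMean T₀ (fun t => ∑ i ∈ s, x i t) = ∑ i ∈ s, preMean T₀ (x i) := by
  simp only [preMean, Finset.mul_sum]
  exact Finset.sum_comm

lemma preMean_congr {T₀ : ℕ} {x y : ℤ → ℝ} (h : ∀ t ≤ 0, x t = y t) :
    preMean T₀ x = preMean T₀ y := by
  unfold preMean
  rw [Finset.sum_congr rfl fun t ht => h t (mem_prePeriods.1 ht).2]

lemma preMean_mono {T₀ : ℕ} {x y : ℤ → ℝ} (h : ∀ t ≤ 0, x t ≤ y t) :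
    preMean T₀ x ≤ preMean T₀ y := by
  unfold preMean
  gcongr with t ht
  exact h t (mem_prePeriods.1 ht).2

lemma preMean_nonneg {T₀ : ℕ} {x : ℤ → ℝ} (h : ∀ t ≤ 0, 0 ≤ x t) : 0 ≤ preMean T₀ x :=
  mul_nonneg (by positivity) (Finset.sum_nonneg fun t ht => h t (mem_prePeriods.1 ht).2)

lemma preMean_const_le (T₀ : ℕ) {c : ℝ} (hc : 0 ≤ c) : preMean T₀ (fun _ => c) ≤ c := by
  rcases Nat.eq_zero_or_pos T₀ with rfl | h
  · simpa [preMean] using hc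
  · have : (T₀ : ℝ) ≠ 0 := by positivity
    simp [preMean, card_prePeriods, this]

lemma abs_preMean_le (T₀ : ℕ) (x : ℤ → ℝ) : |preMean T₀ x| ≤ preMean T₀ fun t => |x t| := by
  unfold preMean
  rw [abs_mul, abs_of_nonneg (by positivity : (0 : ℝ) ≤ (T₀ : ℝ)⁻¹)]
  gcongr
  exact Finset.abs_sum_le_sum_abs _ _

section Integration

variable {Ω : Type*} [MeasurableSpace Ω] {P : Measure Ω}

lemma integrable_preMean {X : ℤ → Ω → ℝ} (hX : ∀ t ≤ 0, Integrable (X t) P) (T₀ : ℕ) :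
    Integrable (fun ω => preMean T₀ fun t => X t ω) P :=
  (integrable_finsetSum _ fun t ht => hX t (mem_prePeriods.1 ht).2).const_mul _

lemma integral_preMean {X : ℤ → Ω → ℝ} (hX : ∀ t ≤ 0, Integrable (X t) P) (T₀ : ℕ) :
    ∫ ω, preMean T₀ (fun t => X t ω) ∂P = preMean T₀ fun t => ∫ ω, X t ω ∂P := by
  unfold preMean
  rw [integral_const_mul, integral_finsetSum _ fun t ht => hX t (mem_prePeriods.1 ht).2]

/-! ### Convergence in probability to zero -/

/-- Convergence in measure to `0` passes to dominated sequences; no measurability is needed, as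
only monotonicity of the outer measure enters. -/
lemma tendstoInMeasure_zero_of_le {f g : ℕ → Ω → ℝ} (hg : TendstoInMeasure P g atTop fun _ => 0)
    (h : ∀ᶠ n in atTop, ∀ ω, |f n ω| ≤ g n ω) : TendstoInMeasure P f atTop fun _ => 0 := by
  rw [tendstoInMeasure_iff_norm] at hg ⊢
  intro ε hε
  refine tendsto_of_tendsto_of_tendsto_of_le_of_le' tendsto_const_nhds (hg ε hε)
    (Eventually.of_forall fun _ => zero_le) ?_
  filter_upwards [h] with n hn
  refine measure_mono fun ω hω => ?_
  simp only [sub_zero, Real.norm_eq_abs, Set.mem_ofPred_eq] at hω ⊢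
  exact hω.trans ((hn ω).trans (le_abs_self _))

lemma tendstoInMeasure_zero_add {f g : ℕ → Ω → ℝ} (hf : TendstoInMeasure P f atTop fun _ => 0)
    (hg : TendstoInMeasure P g atTop fun _ => 0) :
    TendstoInMeasure P (fun n ω => f n ω + g n ω) atTop fun _ => 0 := by
  rw [tendstoInMeasure_iff_norm] at hf hg ⊢
  intro ε hε
  have := (hf (ε / 2) (half_pos hε)).add (hg (ε / 2) (half_pos hε))
  rw [add_zero] at this
  refine tendsto_of_tendsto_of_tendsto_of_le_of_le tendsto_const_nhds this
    (fun _ => zero_le) fun n => ?_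
  refine (measure_mono fun ω hω => ?_).trans (measure_union_le _ _)
  simp only [sub_zero, Real.norm_eq_abs, Set.mem_ofPred_eq, Set.mem_union] at hω ⊢
  by_contra! hcon
  linarith [abs_add_le (f n ω) (g n ω)]

lemma tendstoInMeasure_zero_const_mul {f : ℕ → Ω → ℝ} (c : ℝ)
    (hf : TendstoInMeasure P f atTop fun _ => 0) :
    TendstoInMeasure P (fun n ω => c * f n ω) atTop fun _ => 0 := by
  rw [tendstoInMeasure_iff_norm] at hf ⊢
  intro ε hε
  refine tendsto_of_tendsto_of_tendsto_of_le_of_le tendsto_const_nhds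
    (hf (ε / (|c| + 1)) (by positivity)) (fun _ => zero_le) fun n => measure_mono fun ω hω => ?_
  simp only [sub_zero, Real.norm_eq_abs, Set.mem_ofPred_eq, abs_mul] at hω ⊢
  rw [div_le_iff₀ (by positivity)]
  nlinarith [abs_nonneg (f n ω)]

lemma tendstoInMeasure_zero_sum {ι : Type*} (s : Finset ι) {f : ι → ℕ → Ω → ℝ}
    (hf : ∀ i ∈ s, TendstoInMeasure P (f i) atTop fun _ => 0) :
    TendstoInMeasure P (fun n ω => ∑ i ∈ s, f i n ω) atTop fun _ => 0 := by
  induction s using Finset.cons_induction with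
  | empty =>
    rw [tendstoInMeasure_iff_norm]
    intro ε hε
    simp [hε.not_ge]
  | cons i s hi ih =>
    simp only [Finset.sum_cons]
    exact tendstoInMeasure_zero_add (hf i (by simp)) (ih fun j hj => hf j (by simp [hj]))

lemma tendstoInMeasure_zero_of_tendsto {x : ℕ → ℝ} (hx : Tendsto x atTop (𝓝 0)) :
    TendstoInMeasure P (fun n _ => x n) atTop fun _ => 0 := by
  rw [tendstoInMeasure_iff_norm]
  intro ε hε
  refine tendsto_const_nhds.congr' ?_
  filter_upwards [(tendsto_zero_iff_norm_tendsto_zero.1 hx).eventually (gt_mem_nhds hε)] with n hn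
  have hn' := hn.not_ge
  rw [Real.norm_eq_abs] at hn'
  simp [hn']

/-- If `c f² ≤ E` with `c > 0` and `E` tends to `0` in probability, then so does `f`. -/
lemma tendstoInMeasure_zero_of_sq_le {f E : ℕ → Ω → ℝ} {c : ℝ} (hc : 0 < c)
    (hE : TendstoInMeasure P E atTop fun _ => 0)
    (h : ∀ᶠ n in atTop, ∀ ω, c * f n ω ^ 2 ≤ E n ω) : TendstoInMeasure P f atTop fun _ => 0 := by
  rw [tendstoInMeasure_iff_norm] at hE ⊢
  intro ε hε
  refine tendsto_of_tendsto_of_tendsto_of_le_of_le' tendsto_const_nhds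
    (hE (c * ε ^ 2) (by positivity)) (Eventually.of_forall fun _ => zero_le) ?_
  filter_upwards [h] with n hn
  refine measure_mono fun ω hω => ?_
  simp only [sub_zero, Real.norm_eq_abs, Set.mem_ofPred_eq] at hω ⊢
  refine le_trans ?_ ((hn ω).trans (le_abs_self _))
  rw [← sq_abs (f n ω)]
  gcongr

/-- Markov's inequality: convergence to `0` in mean implies convergence in probability. -/
lemma tendstoInMeasure_zero_of_integral [IsFiniteMeasure P] {f : ℕ → Ω → ℝ}
    (hf : ∀ n, Integrable (f n) P) (h : Tendsto (fun n => ∫ ω, |f n ω| ∂P) atTop (𝓝 0)) :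
    TendstoInMeasure P f atTop fun _ => 0 := by
  rw [tendstoInMeasure_iff_measureReal_norm]
  intro ε hε
  have h' := h.const_mul ε⁻¹
  rw [mul_zero] at h'
  refine tendsto_of_tendsto_of_tendsto_of_le_of_le tendsto_const_nhds h'
    (fun _ => measureReal_nonneg) fun n => ?_
  have := mul_meas_ge_le_integral_of_nonneg (μ := P) (f := fun ω => |f n ω|)
    (Eventually.of_forall fun _ => abs_nonneg _) (hf n).abs ε
  simp only [sub_zero, Real.norm_eq_abs]
  rw [inv_mul_eq_div, le_div_iff₀ hε]
  linarith

/-! ### A weak law of large numbers under strong mixing -/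

/-- The law of large numbers in `L¹`: the variables `X t`, `t ≤ 0`, are integrable, and their averages
over the pre-treatment periods, centred at their expectations, converge to `0` in `L¹`. -/
def MeanLLN (P : Measure Ω) (X : ℤ → Ω → ℝ) : Prop :=
  (∀ t ≤ 0, Integrable (X t) P) ∧
    Tendsto (fun T₀ : ℕ => ∫ ω, |preMean T₀ fun t => X t ω - ∫ ω', X t ω' ∂P| ∂P) atTop (𝓝 0)

lemma MeanLLN.const_mul {X : ℤ → Ω → ℝ} (hX : MeanLLN P X) (c : ℝ) :
    MeanLLN P fun t ω => c * X t ω := by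
  refine ⟨fun t ht => (hX.1 t ht).const_mul c, ?_⟩
  have := hX.2.const_mul |c|
  simpa only [integral_const_mul, ← mul_sub, preMean_const_mul, abs_mul, mul_zero] using this

lemma integrable_preMean_center [IsFiniteMeasure P] {X : ℤ → Ω → ℝ}
    (hX : ∀ t ≤ 0, Integrable (X t) P) (T₀ : ℕ) :
    Integrable (fun ω => preMean T₀ fun t => X t ω - ∫ ω', X t ω' ∂P) P :=
  integrable_preMean (X := fun t ω => X t ω - ∫ ω', X t ω' ∂P)
    (fun t ht => (hX t ht).sub (integrable_const _)) T₀

lemma MeanLLN.sum [IsFiniteMeasure P] {ι : Type*} (s : Finset ι) {X : ι → ℤ → Ω → ℝ}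
    (hX : ∀ i ∈ s, MeanLLN P (X i)) : MeanLLN P fun t ω => ∑ i ∈ s, X i t ω := by
  refine ⟨fun t ht => integrable_finsetSum _ fun i hi => (hX i hi).1 t ht, ?_⟩
  have hlim := tendsto_finsetSum s fun i hi => (hX i hi).2
  rw [Finset.sum_const_zero] at hlim
  refine squeeze_zero (fun _ => integral_nonneg fun _ => abs_nonneg _) (fun T₀ => ?_) hlim
  rw [← integral_finsetSum _ fun i hi => (integrable_preMean_center (hX i hi).1 T₀).abs]
  refine integral_mono_of_nonneg (Eventually.of_forall fun _ => abs_nonneg _)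
    (integrable_finsetSum _ fun i hi => (integrable_preMean_center (hX i hi).1 T₀).abs)
    (Eventually.of_forall fun ω => ?_)
  dsimp only
  have : preMean T₀ (fun t => ∑ i ∈ s, X i t ω - ∫ ω', ∑ i ∈ s, X i t ω' ∂P) =
      ∑ i ∈ s, preMean T₀ fun t => X i t ω - ∫ ω', X i t ω' ∂P := by
    rw [← preMean_sum]
    refine preMean_congr fun t ht => ?_
    rw [integral_finsetSum _ fun i hi => (hX i hi).1 t ht, Finset.sum_sub_distrib]
  rw [this]
  exact Finset.abs_sum_le_sum_abs _ _

/-- The `L¹` law of large numbers is stable under uniform `L¹` approximation. -/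
lemma MeanLLN.of_approx [IsProbabilityMeasure P] {X : ℤ → Ω → ℝ}
    (hX : ∀ t ≤ 0, Integrable (X t) P)
    (h : ∀ η > 0, ∃ Z : ℤ → Ω → ℝ, MeanLLN P Z ∧ ∀ t ≤ 0, ∫ ω, |X t ω - Z t ω| ∂P ≤ η) :
    MeanLLN P X := by
  refine ⟨hX, ?_⟩
  rw [Metric.tendsto_atTop]
  intro ε hε
  obtain ⟨Z, hZ, hXZ⟩ := h (ε / 4) (by positivity)
  obtain ⟨N, hN⟩ := Metric.tendsto_atTop.1 hZ.2 (ε / 4) (by positivity)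
  refine ⟨N, fun T₀ hT => ?_⟩
  have hZT := hN T₀ hT
  rw [Real.dist_eq, sub_zero, abs_of_nonneg (integral_nonneg fun _ => abs_nonneg _)] at hZT ⊢
  have hd : ∀ t ≤ 0, Integrable (fun ω => |X t ω - Z t ω|) P := fun t ht =>
    ((hX t ht).sub (hZ.1 t ht)).abs
  have hpt : ∀ ω, |preMean T₀ fun t => X t ω - ∫ ω', X t ω' ∂P| ≤
      preMean T₀ (fun t => |X t ω - Z t ω|) +
        |preMean T₀ fun t => Z t ω - ∫ ω', Z t ω' ∂P| + ε / 4 := by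
    intro ω
    have e : preMean T₀ (fun t => X t ω - ∫ ω', X t ω' ∂P) =
        preMean T₀ (fun t => X t ω - Z t ω) + preMean T₀ (fun t => Z t ω - ∫ ω', Z t ω' ∂P) +
          preMean T₀ (fun t => ∫ ω', Z t ω' ∂P - ∫ ω', X t ω' ∂P) := by
      rw [← preMean_add, ← preMean_add]
      exact preMean_congr fun t _ => by ring
    have h3 : |preMean T₀ (fun t => ∫ ω', Z t ω' ∂P - ∫ ω', X t ω' ∂P)| ≤ ε / 4 := by
      refine (abs_preMean_le _ _).trans
        ((preMean_mono fun t ht => ?_).trans (preMean_const_le T₀ (by positivity)))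
      rw [← integral_sub (hZ.1 t ht) (hX t ht)]
      refine (abs_integral_le_integral_abs).trans (le_trans (le_of_eq ?_) (hXZ t ht))
      exact integral_congr_ae (Eventually.of_forall fun ω => abs_sub_comm _ _)
    rw [e]
    refine (abs_add_le _ _).trans (add_le_add ((abs_add_le _ _).trans ?_) h3)
    gcongr
    exact abs_preMean_le _ _
  have h1 : ∫ ω, preMean T₀ (fun t => |X t ω - Z t ω|) ∂P ≤ ε / 4 := by
    rw [integral_preMean hd]
    exact (preMean_mono hXZ).trans (preMean_const_le T₀ (by positivity))
  have i1 := integrable_preMean hd T₀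
  have i2 := (integrable_preMean_center hZ.1 T₀).abs
  calc ∫ ω, |preMean T₀ fun t => X t ω - ∫ ω', X t ω' ∂P| ∂P
      ≤ ∫ ω, (preMean T₀ (fun t => |X t ω - Z t ω|) +
        |preMean T₀ fun t => Z t ω - ∫ ω', Z t ω' ∂P| + ε / 4) ∂P :=
        integral_mono (integrable_preMean_center hX T₀).abs
          ((i1.add i2).add (integrable_const _)) hpt
    _ = ∫ ω, preMean T₀ (fun t => |X t ω - Z t ω|) ∂P +
        ∫ ω, |preMean T₀ fun t => Z t ω - ∫ ω', Z t ω' ∂P| ∂P + ε / 4 := by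
        have e1 := integral_add (i1.add i2) (integrable_const (μ := P) (ε / 4))
        have e2 := integral_add i1 i2
        simp only [Pi.add_apply, integral_const, probReal_univ, one_smul] at e1 e2
        rw [e1, e2]
    _ < ε := by linarith

lemma sum_prePeriods_natAbs_le {a : ℕ → ℝ} (ha : ∀ k, 0 ≤ a k) (T₀ : ℕ) {s : ℤ}
    (hs : s ∈ prePeriods T₀) :
    ∑ t ∈ prePeriods T₀, a (s - t).natAbs ≤ 2 * ∑ k ∈ Finset.range T₀, a k := by
  -- each lag `k < T₀` occurs at most once in the past of `s` and at most once in its future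
  have key : ∀ S ⊆ prePeriods T₀, Set.InjOn (fun t => (s - t).natAbs) S →
      ∑ t ∈ S, a (s - t).natAbs ≤ ∑ k ∈ Finset.range T₀, a k := by
    intro S hS hinj
    rw [← Finset.sum_image (f := a) hinj]
    refine Finset.sum_le_sum_of_subset_of_nonneg ?_ fun k _ _ => ha k
    intro k hk
    obtain ⟨t, ht, rfl⟩ := Finset.mem_image.1 hk
    have := mem_prePeriods.1 (hS ht)
    have := mem_prePeriods.1 hs
    rw [Finset.mem_range]
    omega
  rw [← Finset.sum_filter_add_sum_filter_not (prePeriods T₀) (fun t => t ≤ s), two_mul]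
  refine add_le_add (key _ (Finset.filter_subset _ _) ?_) (key _ (Finset.filter_subset _ _) ?_)
  · intro t ht u hu htu
    simp only [Finset.coe_filter, Set.mem_ofPred_eq] at ht hu htu
    omega
  · intro t ht u hu htu
    simp only [Finset.coe_filter, Set.mem_ofPred_eq] at ht hu htu
    omega

/-- Square integrable variables whose covariances decay with the time lag satisfy the law of large
numbers: the variance of the average is at most twice the Cesàro mean of the decay rates. -/
lemma MeanLLN.of_covariance_le [IsProbabilityMeasure P] {X : ℤ → Ω → ℝ}
    (hX : ∀ t ≤ 0, MemLp (X t) 2 P) {a : ℕ → ℝ} (ha : ∀ k, 0 ≤ a k)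
    (ha0 : Tendsto a atTop (𝓝 0))
    (hcov : ∀ s ≤ 0, ∀ t ≤ 0, cov[X s, X t; P] ≤ a (s - t).natAbs) : MeanLLN P X := by
  have hint : ∀ t ≤ 0, Integrable (X t) P := fun t ht => (hX t ht).integrable (by norm_num)
  refine ⟨hint, ?_⟩
  have hlim : Tendsto (fun T₀ : ℕ => √(2 * ((T₀ : ℝ)⁻¹ * ∑ k ∈ Finset.range T₀, a k))) atTop
      (𝓝 0) := by
    have := (ha0.cesaro.const_mul 2).sqrt
    simpa using this
  refine squeeze_zero (fun _ => integral_nonneg fun _ => abs_nonneg _) (fun T₀ => ?_) hlim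
  set Y : Ω → ℝ := fun ω => preMean T₀ fun t => X t ω with hY
  have hYm : MemLp Y 2 P :=
    (memLp_finsetSum _ fun t ht => hX t (mem_prePeriods.1 ht).2).const_mul _
  have hcenter : ∀ ω, preMean T₀ (fun t => X t ω - ∫ ω', X t ω' ∂P) = Y ω - ∫ ω', Y ω' ∂P := by
    intro ω
    rw [preMean_sub, hY, integral_preMean hint]
  simp only [hcenter]
  have hvar : Var[Y; P] ≤ 2 * ((T₀ : ℝ)⁻¹ * ∑ k ∈ Finset.range T₀, a k) := by
    have h1 : Var[Y; P] = ((T₀ : ℝ)⁻¹) ^ 2 *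
        ∑ s ∈ prePeriods T₀, ∑ t ∈ prePeriods T₀, cov[X s, X t; P] := by
      rw [← variance_fun_sum' fun t ht => hX t (mem_prePeriods.1 ht).2, ← variance_const_mul]
      rfl
    rw [h1]
    have h2 : ∑ s ∈ prePeriods T₀, ∑ t ∈ prePeriods T₀, cov[X s, X t; P] ≤
        T₀ * (2 * ∑ k ∈ Finset.range T₀, a k) := by
      have := Finset.sum_le_card_nsmul (prePeriods T₀)
        (fun s => ∑ t ∈ prePeriods T₀, cov[X s, X t; P]) (2 * ∑ k ∈ Finset.range T₀, a k)
        fun s hs => (Finset.sum_le_sum fun t ht =>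
          hcov s (mem_prePeriods.1 hs).2 t (mem_prePeriods.1 ht).2).trans
            (sum_prePeriods_natAbs_le ha T₀ hs)
      simpa [card_prePeriods] using this
    rcases Nat.eq_zero_or_pos T₀ with rfl | hT
    · simp
    · have hT' : (0 : ℝ) < T₀ := by exact_mod_cast hT
      calc ((T₀ : ℝ)⁻¹) ^ 2 * ∑ s ∈ prePeriods T₀, ∑ t ∈ prePeriods T₀, cov[X s, X t; P]
          ≤ ((T₀ : ℝ)⁻¹) ^ 2 * (T₀ * (2 * ∑ k ∈ Finset.range T₀, a k)) := by gcongr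
        _ = _ := by field_simp
  refine Real.le_sqrt_of_sq_le (le_trans ?_ hvar)
  have hD : MemLp (fun ω => |Y ω - ∫ ω', Y ω' ∂P|) 2 P := (hYm.sub (memLp_const _)).abs
  have h0 := variance_nonneg (fun ω => |Y ω - ∫ ω', Y ω' ∂P|) P
  rw [variance_eq_sub hD] at h0
  rw [variance_eq_integral hYm.aemeasurable]
  simp only [Pi.pow_apply, sq_abs] at h0
  linarith

/-- Indicators of a fixed event for a strongly mixing process satisfy the law of large numbers. -/
lemma MeanLLN.indicator_of_mixing [IsProbabilityMeasure P] {E : Type*} [MeasurableSpace E]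
    {X : ℤ → Ω → E} (hX : ∀ t ≤ 0, Measurable (X t)) (hmix : IsAlphaMixing P X (Set.Iic 0))
    {S : Set E} (hS : MeasurableSet S) :
    MeanLLN P fun t => (X t ⁻¹' S).indicator fun _ => (1 : ℝ) := by
  have hm : ∀ t ≤ 0, MeasurableSet (X t ⁻¹' S) := fun t ht => hX t ht hS
  -- truncation at `1` turns the extended mixing coefficients into real numbers
  refine MeanLLN.of_covariance_le (a := fun k => (min (mixingCoeff P X (Set.Iic 0) k) 1).toReal)
    (fun t ht => (memLp_const (1 : ℝ)).indicator (hm t ht)) (fun _ => ENNReal.toReal_nonneg) ?_ ?_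
  · have h1 : Tendsto (fun k => min (mixingCoeff P X (Set.Iic 0) k) 1) atTop (𝓝 0) := by
      simpa using hmix.min (tendsto_const_nhds (x := (1 : ℝ≥0∞)))
    exact (ENNReal.tendsto_toReal ENNReal.zero_ne_top).comp h1
  · have hcov : ∀ s ≤ 0, ∀ t ≤ 0, cov[(X s ⁻¹' S).indicator fun _ => (1 : ℝ),
        (X t ⁻¹' S).indicator fun _ => (1 : ℝ); P] =
        P.real (X s ⁻¹' S ∩ X t ⁻¹' S) - P.real (X s ⁻¹' S) * P.real (X t ⁻¹' S) := by
      intro s hs t ht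
      rw [covariance_eq_sub ((memLp_const (1 : ℝ)).indicator (hm s hs))
        ((memLp_const (1 : ℝ)).indicator (hm t ht)),
        integral_indicator_const _ (hm s hs), integral_indicator_const _ (hm t ht)]
      have e : ((X s ⁻¹' S).indicator fun _ => (1 : ℝ)) * ((X t ⁻¹' S).indicator fun _ => (1 : ℝ)) =
          (X s ⁻¹' S ∩ X t ⁻¹' S).indicator fun _ => (1 : ℝ) := by
        ext ω
        simpa using (Set.inter_indicator_mul (s := X s ⁻¹' S) (t := X t ⁻¹' S)
          (fun _ => (1 : ℝ)) (fun _ => (1 : ℝ)) ω).symm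
      rw [e, integral_indicator_const _ ((hm s hs).inter (hm t ht))]
      simp
    have hgen : ∀ (U : Set ℤ) (t : ℤ), t ∈ U → MeasurableSet[sigmaGen X U] (X t ⁻¹' S) := by
      intro U t ht
      exact (le_iSup₂ (f := fun s (_ : s ∈ U) =>
        MeasurableSpace.comap (X s) inferInstance) t ht) _ ⟨S, hS, rfl⟩
    have hle : ∀ s ≤ 0, ∀ t ≤ 0, s ≤ t → cov[(X s ⁻¹' S).indicator fun _ => (1 : ℝ),
        (X t ⁻¹' S).indicator fun _ => (1 : ℝ); P] ≤
        (min (mixingCoeff P X (Set.Iic 0) (s - t).natAbs) 1).toReal := by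
      intro s hs t ht hst
      rw [hcov s hs t ht]
      have htop : min (mixingCoeff P X (Set.Iic 0) (s - t).natAbs) 1 ≠ ⊤ :=
        ne_top_of_le_ne_top ENNReal.one_ne_top (min_le_right _ _)
      rw [← ENNReal.ofReal_le_iff_le_toReal htop]
      refine le_min ?_ ?_
      · refine (ENNReal.ofReal_le_ofReal (le_abs_self _)).trans ?_
        unfold mixingCoeff
        refine le_trans ?_ (le_iSup _ s)
        unfold alphaCoeff
        refine le_trans ?_ (le_iSup₂ (X s ⁻¹' S) (X t ⁻¹' S))
        exact le_iSup₂ (f := fun _ _ => ENNReal.ofReal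
          |P.real (X s ⁻¹' S ∩ X t ⁻¹' S) - P.real (X s ⁻¹' S) * P.real (X t ⁻¹' S)|)
          (hgen _ s ⟨hs, le_refl s⟩) (hgen _ t ⟨ht, by omega⟩)
      · rw [← ENNReal.ofReal_one]
        refine ENNReal.ofReal_le_ofReal ?_
        have := measureReal_le_one (μ := P) (s := X s ⁻¹' S ∩ X t ⁻¹' S)
        nlinarith [mul_nonneg (measureReal_nonneg (μ := P) (s := X s ⁻¹' S))
          (measureReal_nonneg (μ := P) (s := X t ⁻¹' S))]
    intro s hs t ht
    rcases le_total s t with h | h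
    · exact hle s hs t ht h
    · rw [covariance_comm, ← Int.natAbs_neg, neg_sub]
      exact hle t ht s hs h

/-- A nonnegative `x` is approximated by the staircase with `n` steps of height `h`, up to `h` plus
a tail controlled by `x²`. -/
lemma abs_sub_staircase_le {x h : ℝ} (hx : 0 ≤ x) (hh : 0 < h) {n : ℕ} (hn : 0 < n) :
    |x - ∑ i ∈ Finset.range n, h * (if (i + 1) * h ≤ x then (1 : ℝ) else 0)| ≤
      h + x ^ 2 / (n * h) := by
  have key : ∀ m : ℕ,
      (x < m * h ∧ ∑ i ∈ Finset.range m, h * (if (i + 1) * h ≤ x then (1 : ℝ) else 0) ≤ x ∧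
        x - ∑ i ∈ Finset.range m, h * (if (i + 1) * h ≤ x then (1 : ℝ) else 0) ≤ h) ∨
      (m * h ≤ x ∧
        ∑ i ∈ Finset.range m, h * (if (i + 1) * h ≤ x then (1 : ℝ) else 0) = m * h) := by
    intro m
    induction m with
    | zero => right; simpa using hx
    | succ m ih =>
      rw [Finset.sum_range_succ]
      push_cast
      rcases ih with ⟨h1, h2, h3⟩ | ⟨h1, h2⟩
      · left
        have hlt : ¬ ((m : ℝ) + 1) * h ≤ x := by nlinarith
        simp only [hlt, if_false, mul_zero, add_zero]
        exact ⟨by nlinarith, h2, h3⟩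
      · by_cases hle : ((m : ℝ) + 1) * h ≤ x
        · right
          simp only [hle, if_true, h2, true_and]
          ring
        · left
          simp only [hle, if_false, h2, mul_zero, add_zero]
          exact ⟨not_le.1 hle, h1, by linarith⟩
  have hnh : 0 < (n : ℝ) * h := by positivity
  rcases key n with ⟨-, h2, h3⟩ | ⟨h1, h2⟩
  · rw [abs_of_nonneg (by linarith)]
    linarith [div_nonneg (sq_nonneg x) hnh.le]
  · rw [h2, abs_of_nonneg (by linarith)]
    have : x ≤ x ^ 2 / (n * h) := by
      rw [le_div_iff₀ hnh]
      nlinarith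
    linarith

/-- The squares of a strongly mixing process with bounded fourth moments satisfy the law of large
numbers: they are approximated in `L¹` by finite combinations of indicators of events. -/
lemma MeanLLN.sq_of_mixing [IsProbabilityMeasure P] {E : Type*} [MeasurableSpace E]
    {X : ℤ → Ω → E} (hX : ∀ t ≤ 0, Measurable (X t)) (hmix : IsAlphaMixing P X (Set.Iic 0))
    {g : E → ℝ} (hg : Measurable g) {C : ℝ}
    (hint : ∀ t ≤ 0, Integrable (fun ω => g (X t ω) ^ 4) P)
    (hC : ∀ t ≤ 0, ∫ ω, g (X t ω) ^ 4 ∂P ≤ C) : MeanLLN P fun t ω => g (X t ω) ^ 2 := by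
  have hsq : ∀ t ≤ 0, Integrable (fun ω => g (X t ω) ^ 2) P := by
    intro t ht
    refine ((integrable_const (1 : ℝ)).add (hint t ht)).mono'
      ((hg.comp (hX t ht)).pow_const 2).aestronglyMeasurable (Eventually.of_forall fun ω => ?_)
    rw [Real.norm_eq_abs, abs_of_nonneg (sq_nonneg _)]
    simp only [Pi.add_apply]
    nlinarith [sq_nonneg (g (X t ω) ^ 2 - 1)]
  refine MeanLLN.of_approx hsq fun η hη => ?_
  -- step height `η / 2`, and enough steps to make the tail bound `C / (n h)` at most `η / 2`
  set h : ℝ := η / 2 with hh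
  have hh0 : 0 < h := by positivity
  obtain ⟨n, hn⟩ := exists_nat_gt (max 0 (C / (h * h)))
  have hn0 : 0 < n := by exact_mod_cast (le_max_left _ _).trans_lt hn
  have hnC : C / (n * h) ≤ h := by
    have hn1 := (le_max_right _ _).trans_lt hn
    rw [div_lt_iff₀ (by positivity)] at hn1
    rw [div_le_iff₀ (by positivity)]
    nlinarith
  refine ⟨fun t ω => ∑ i ∈ Finset.range n,
    h * (X t ⁻¹' {x | (i + 1) * h ≤ g x ^ 2}).indicator (fun _ => (1 : ℝ)) ω, ?_, ?_⟩
  · exact MeanLLN.sum _ fun i _ => (MeanLLN.indicator_of_mixing hX hmix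
      (measurableSet_le measurable_const (hg.pow_const 2))).const_mul h
  · intro t ht
    have hbd : ∀ ω, |g (X t ω) ^ 2 - ∑ i ∈ Finset.range n,
        h * (X t ⁻¹' {x | (i + 1) * h ≤ g x ^ 2}).indicator (fun _ => (1 : ℝ)) ω| ≤
        h + g (X t ω) ^ 4 / (n * h) := by
      intro ω
      have := abs_sub_staircase_le (sq_nonneg (g (X t ω))) hh0 hn0
      rw [← pow_mul] at this
      simpa [Set.indicator_apply] using this
    calc ∫ ω, |g (X t ω) ^ 2 - ∑ i ∈ Finset.range n,
          h * (X t ⁻¹' {x | (i + 1) * h ≤ g x ^ 2}).indicator (fun _ => (1 : ℝ)) ω| ∂P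
        ≤ ∫ ω, (h + g (X t ω) ^ 4 / (n * h)) ∂P :=
          integral_mono_of_nonneg (Eventually.of_forall fun _ => abs_nonneg _)
            ((integrable_const _).add ((hint t ht).div_const _)) (Eventually.of_forall hbd)
      _ = h + (∫ ω, g (X t ω) ^ 4 ∂P) / (n * h) := by
          rw [integral_add (integrable_const _) ((hint t ht).div_const _), integral_div (n * h)]
          simp only [integral_const, probReal_univ, one_smul]
      _ ≤ h + C / (n * h) := by gcongr; exact hC t ht
      _ ≤ η := by linarith

end Integration

/-! ### Simplex weights and Euclidean norms -/

lemma norm2_sq {n : ℕ} (v : Fin n → ℝ) : norm2 v ^ 2 = ∑ i, v i ^ 2 := by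
  simp [norm2, EuclideanSpace.real_norm_sq_eq]

lemma norm2_nonneg {n : ℕ} (v : Fin n → ℝ) : 0 ≤ norm2 v := norm_nonneg _

lemma abs_apply_le_norm2 {n : ℕ} (v : Fin n → ℝ) (i : Fin n) : |v i| ≤ norm2 v := by
  refine abs_le_of_sq_le_sq ?_ (norm2_nonneg v)
  rw [norm2_sq]
  exact Finset.single_le_sum (f := fun i => v i ^ 2) (fun i _ => sq_nonneg _) (Finset.mem_univ i)

lemma abs_sum_simplex_le {n : ℕ} {w : Fin n → ℝ} (hw : w ∈ stdSimplex ℝ (Fin n)) {x : Fin n → ℝ}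
    {B : ℝ} (hx : ∀ j, |x j| ≤ B) : |∑ j, w j * x j| ≤ B := by
  calc |∑ j, w j * x j| ≤ ∑ j, |w j * x j| := Finset.abs_sum_le_sum_abs _ _
    _ ≤ ∑ j, w j * B := by
        gcongr with j
        rw [abs_mul, abs_of_nonneg (hw.1 j)]
        exact mul_le_mul_of_nonneg_left (hx j) (hw.1 j)
    _ = B := by rw [← Finset.sum_mul, hw.2, one_mul]

lemma norm2_sq_le_one {n : ℕ} {w : Fin n → ℝ} (hw : w ∈ stdSimplex ℝ (Fin n)) :
    norm2 w ^ 2 ≤ 1 := by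
  rw [norm2_sq, ← hw.2]
  gcongr with j
  have : w j ≤ 1 := hw.2 ▸ Finset.single_le_sum (fun i _ => hw.1 i) (Finset.mem_univ j)
  nlinarith [hw.1 j]

lemma le_iSup_fin {ι : Type*} [Finite ι] (f : ι → ℝ) (i : ι) : f i ≤ ⨆ i, f i :=
  le_ciSup (Set.finite_range f).bddAbove i

/-! ### Decomposition of the pre-treatment fit -/

section Deterministic

variable {F : ℕ} (lam : ℤ → Fin F → ℝ) (mu : ℕ → Fin F → ℝ) (e : ℕ → ℤ → ℝ) (T₀ J : ℕ)

/-- The difference `μ₀ - M_J' w` between the loadings of the treated unit and those reconstructed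
by the weights `w`. -/
noncomputable def loadingGap (w : Fin J → ℝ) : Fin F → ℝ := mu 0 - (loadingMatrix mu J)ᵀ *ᵥ w

/-- The average squared factor contribution `T₀⁻¹ ∑ (λ_t δ)²` of a loading gap `δ`. -/
noncomputable def factorFit (δ : Fin F → ℝ) : ℝ := preMean T₀ fun t => (lam t ⬝ᵥ δ) ^ 2

/-- The average squared shock `T₀⁻¹ ∑ (w' ε_t)²` of the weighted controls. -/
noncomputable def noiseFit (w : Fin J → ℝ) : ℝ :=
  preMean T₀ fun t => (∑ j : Fin J, w j * e (j + 1) t) ^ 2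

/-- Largest average product of the treated unit's shocks with those of a control. -/
noncomputable def treatedCross : ℝ := ⨆ j : Fin J, |preMean T₀ fun t => e 0 t * e (j + 1) t|

/-- Largest average product of the `f`-th factor with the shocks of a unit. -/
noncomputable def factorCross (f : Fin F) : ℝ :=
  ⨆ j : Fin (J + 1), |preMean T₀ fun t => lam t f * e j t|

/-- Bound, uniform over the simplex, for the cross terms of the pre-treatment fit when the
coordinates of the loading gap are at most `D` in absolute value. -/
noncomputable def crossBound (D : ℝ) : ℝ :=
  4 * D * ∑ f, factorCross lam e T₀ J f + 2 * treatedCross e T₀ J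

lemma factorFit_nonneg (δ : Fin F → ℝ) : 0 ≤ factorFit lam T₀ δ :=
  preMean_nonneg fun _ _ => sq_nonneg _

lemma noiseFit_nonneg (w : Fin J → ℝ) : 0 ≤ noiseFit e T₀ J w :=
  preMean_nonneg fun _ _ => sq_nonneg _

variable {lam mu e T₀ J}

lemma abs_loadingGap_le {C : ℝ} (hC : ∀ i, norm2 (mu i) ≤ C) {w : Fin J → ℝ}
    (hw : w ∈ stdSimplex ℝ (Fin J)) (f : Fin F) : |loadingGap mu J w f| ≤ 2 * C := by
  have h0 : |mu 0 f| ≤ C := (abs_apply_le_norm2 _ f).trans (hC 0)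
  have h1 : |((loadingMatrix mu J)ᵀ *ᵥ w) f| ≤ C := by
    have := abs_sum_simplex_le hw (x := fun j => mu (j + 1) f) fun j =>
      (abs_apply_le_norm2 _ f).trans (hC (j + 1))
    simpa [Matrix.mulVec, dotProduct, loadingMatrix, mul_comm] using this
  simp only [loadingGap, Pi.sub_apply]
  linarith [abs_sub (mu 0 f) (((loadingMatrix mu J)ᵀ *ᵥ w) f)]

lemma dotProduct_loadingGap (v : Fin F → ℝ) (w : Fin J → ℝ) :
    v ⬝ᵥ loadingGap mu J w = v ⬝ᵥ mu 0 - ∑ j : Fin J, w j * (v ⬝ᵥ mu (j + 1)) := by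
  rw [loadingGap, dotProduct_sub, Matrix.dotProduct_mulVec, dotProduct_comm (v ᵥ* _)]
  congr 1

/-- Uniformly over the simplex, the pre-treatment fit splits into the factor part, the treated
unit's own shocks and the noise of the weighted controls, up to the cross terms. -/
lemma abs_preFit_sub_le {y : ℕ → ℤ → ℝ} (hy : ∀ i, ∀ t ≤ 0, y i t = lam t ⬝ᵥ mu i + e i t)
    {w : Fin J → ℝ} (hw : w ∈ stdSimplex ℝ (Fin J)) {D : ℝ}
    (hD : ∀ f, |loadingGap mu J w f| ≤ D) :
    |preFit y T₀ J w - (factorFit lam T₀ (loadingGap mu J w) + preMean T₀ (fun t => e 0 t ^ 2) +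
      noiseFit e T₀ J w)| ≤ crossBound lam e T₀ J D := by
  set δ := loadingGap mu J w with hδ
  have hres : ∀ t ≤ 0, y 0 t - ∑ j : Fin J, w j * y (j + 1) t =
      lam t ⬝ᵥ δ + e 0 t - ∑ j : Fin J, w j * e (j + 1) t := by
    intro t ht
    rw [hδ, dotProduct_loadingGap, hy 0 t ht]
    simp only [hy _ t ht, mul_add, Finset.sum_add_distrib]
    ring
  have hfac : ∀ f, ∀ j : Fin (J + 1),
      |preMean T₀ fun t => lam t f * e j t| ≤ factorCross lam e T₀ J f := fun f j =>
    le_iSup_fin (fun j : Fin (J + 1) => |preMean T₀ fun t => lam t f * e j t|) j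
  have hgap : ∀ x : Fin F → ℝ, (∀ f, |x f| ≤ factorCross lam e T₀ J f) →
      |∑ f, δ f * x f| ≤ D * ∑ f, factorCross lam e T₀ J f := by
    intro x hx
    rw [Finset.mul_sum]
    refine (Finset.abs_sum_le_sum_abs _ _).trans (Finset.sum_le_sum fun f _ => ?_)
    rw [abs_mul]
    exact mul_le_mul (hD f) (hx f) (abs_nonneg _) ((abs_nonneg _).trans (hD f))
  have h1 : |preMean T₀ fun t => (lam t ⬝ᵥ δ) * e 0 t| ≤
      D * ∑ f, factorCross lam e T₀ J f := by
    have he : preMean T₀ (fun t => (lam t ⬝ᵥ δ) * e 0 t) =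
        ∑ f, δ f * preMean T₀ fun t => lam t f * e 0 t := by
      simp only [← preMean_const_mul]
      rw [← preMean_sum]
      refine preMean_congr fun t _ => ?_
      rw [dotProduct, Finset.sum_mul]
      exact Finset.sum_congr rfl fun f _ => by ring
    rw [he]
    exact hgap _ fun f => hfac f 0
  have h2 : |preMean T₀ fun t => (lam t ⬝ᵥ δ) * ∑ j : Fin J, w j * e (j + 1) t| ≤
      D * ∑ f, factorCross lam e T₀ J f := by
    have he : preMean T₀ (fun t => (lam t ⬝ᵥ δ) * ∑ j : Fin J, w j * e (j + 1) t) =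
        ∑ f, δ f * ∑ j : Fin J, w j * preMean T₀ fun t => lam t f * e (j + 1) t := by
      simp only [← preMean_const_mul]
      simp only [← preMean_sum, ← preMean_const_mul]
      refine preMean_congr fun t _ => ?_
      rw [dotProduct, Finset.sum_mul]
      refine Finset.sum_congr rfl fun f _ => ?_
      rw [Finset.mul_sum, Finset.mul_sum]
      exact Finset.sum_congr rfl fun j _ => by ring
    rw [he]
    refine hgap _ fun f => abs_sum_simplex_le hw fun j => ?_
    simpa using hfac f j.succ
  have h3 : |preMean T₀ fun t => e 0 t * ∑ j : Fin J, w j * e (j + 1) t| ≤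
      treatedCross e T₀ J := by
    have he : preMean T₀ (fun t => e 0 t * ∑ j : Fin J, w j * e (j + 1) t) =
        ∑ j : Fin J, w j * preMean T₀ fun t => e 0 t * e (j + 1) t := by
      simp only [← preMean_const_mul]
      rw [← preMean_sum]
      refine preMean_congr fun t _ => ?_
      rw [Finset.mul_sum]
      exact Finset.sum_congr rfl fun j _ => by ring
    rw [he]
    exact abs_sum_simplex_le hw
      (le_iSup_fin fun j : Fin J => |preMean T₀ fun t => e 0 t * e (j + 1) t|)
  have hexp : preFit y T₀ J w - (factorFit lam T₀ δ + preMean T₀ (fun t => e 0 t ^ 2) +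
      noiseFit e T₀ J w) =
      2 * preMean T₀ (fun t => (lam t ⬝ᵥ δ) * e 0 t) -
        2 * preMean T₀ (fun t => (lam t ⬝ᵥ δ) * ∑ j : Fin J, w j * e (j + 1) t) -
        2 * preMean T₀ (fun t => e 0 t * ∑ j : Fin J, w j * e (j + 1) t) := by
    simp only [preFit, factorFit, noiseFit]
    rw [← preMean_const_mul, ← preMean_const_mul, ← preMean_const_mul, ← preMean_sub,
      ← preMean_sub, ← preMean_add, ← preMean_add, ← preMean_sub]
    refine preMean_congr fun t ht => ?_
    rw [hres t ht]
    ring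
  rw [hexp, crossBound]
  rw [abs_le] at h1 h2 h3 ⊢
  constructor <;> linarith [h1.1, h1.2, h2.1, h2.2, h3.1, h3.2]

/-- Comparison of the minimizer with any competitor in the simplex: the treated unit's own shocks
enter both fits equally and cancel. -/
lemma IsSCWeights.factorFit_add_noiseFit_le {y : ℕ → ℤ → ℝ}
    (hy : ∀ i, ∀ t ≤ 0, y i t = lam t ⬝ᵥ mu i + e i t) {C : ℝ} (hC : ∀ i, norm2 (mu i) ≤ C)
    {w v : Fin J → ℝ} (hw : IsSCWeights y T₀ J w) (hv : v ∈ stdSimplex ℝ (Fin J)) :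
    factorFit lam T₀ (loadingGap mu J w) + noiseFit e T₀ J w ≤
      factorFit lam T₀ (loadingGap mu J v) + noiseFit e T₀ J v +
        2 * crossBound lam e T₀ J (2 * C) := by
  have h1 := abs_le.1 (abs_preFit_sub_le (T₀ := T₀) hy hw.1 (abs_loadingGap_le hC hw.1))
  have h2 := abs_le.1 (abs_preFit_sub_le (T₀ := T₀) hy hv (abs_loadingGap_le hC hv))
  have h3 : preFit y T₀ J w ≤ preFit y T₀ J v := hw.2 hv
  linarith [h1.1, h1.2, h2.1, h2.2]

/-- If the controls' average squared shocks are at least `c`, the noise of the weighted controls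
bounds the squared norm of the weights, up to the average products between distinct controls. -/
lemma norm2_sq_le_noiseFit {w : Fin J → ℝ} (hw : w ∈ stdSimplex ℝ (Fin J)) {c U : ℝ}
    (hc : ∀ j : Fin J, c ≤ preMean T₀ fun t => e (j + 1) t ^ 2) (hU0 : 0 ≤ U)
    (hU : ∀ i j : Fin J, i ≠ j → |preMean T₀ fun t => e (i + 1) t * e (j + 1) t| ≤ U) :
    c * norm2 w ^ 2 ≤ noiseFit e T₀ J w + U := by
  have hexp : noiseFit e T₀ J w = ∑ i : Fin J, ∑ j : Fin J,
      w i * w j * preMean T₀ fun t => e (i + 1) t * e (j + 1) t := by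
    simp only [← preMean_const_mul, ← preMean_sum]
    refine preMean_congr fun t _ => ?_
    rw [sq, Finset.sum_mul_sum]
    exact Finset.sum_congr rfl fun i _ => Finset.sum_congr rfl fun j _ => by ring
  have hone : ∑ i : Fin J, ∑ j : Fin J, w i * w j * U = U := by
    simp only [← Finset.sum_mul, ← Finset.mul_sum, hw.2, one_mul, mul_one]
  have hdiag : c * norm2 w ^ 2 = ∑ i : Fin J, ∑ j : Fin J, if i = j then c * w i ^ 2 else 0 := by
    simp [norm2_sq, Finset.mul_sum]
  rw [hexp, hdiag, ← sub_le_iff_le_add]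
  nth_rewrite 1 [← hone]
  simp only [← Finset.sum_sub_distrib]
  refine Finset.sum_le_sum fun i _ => Finset.sum_le_sum fun j _ => ?_
  have hij := mul_nonneg (hw.1 i) (hw.1 j)
  split_ifs with h
  · subst h
    have := hc i
    simp only [← sq] at hij ⊢
    nlinarith
  · have := (abs_le.1 (hU i j h)).1
    nlinarith

end Deterministic

/-! ### Second moments of the factors -/

lemma factorFit_eq_dotProduct_mulVec {F : ℕ} (lam : ℤ → Fin F → ℝ) (T₀ : ℕ) (δ : Fin F → ℝ) :
    factorFit lam T₀ δ =
      δ ⬝ᵥ ((T₀ : ℝ)⁻¹ • ∑ t ∈ prePeriods T₀, Matrix.vecMulVec (lam t) (lam t)) *ᵥ δ := by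
  rw [Matrix.smul_mulVec, Matrix.sum_mulVec, dotProduct_smul, dotProduct_sum, factorFit, preMean,
    smul_eq_mul]
  congr 1
  refine Finset.sum_congr rfl fun t _ => ?_
  rw [Matrix.vecMulVec_mulVec, dotProduct_smul, dotProduct_comm δ]
  simp [sq]

/-- Matrices converging to a positive definite limit are eventually uniformly coercive, by
compactness of the unit sphere. -/
lemma eventually_coercive {n : ℕ} {M : ℕ → Matrix (Fin n) (Fin n) ℝ}
    {Om : Matrix (Fin n) (Fin n) ℝ} (hOm : Om.PosDef) (hM : Tendsto M atTop (𝓝 Om)) :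
    ∃ κ : ℝ, 0 < κ ∧ ∀ᶠ k in atTop, ∀ v : Fin n → ℝ, κ * norm2 v ^ 2 ≤ v ⬝ᵥ M k *ᵥ v := by
  have hcont : Continuous fun p : EuclideanSpace ℝ (Fin n) × Matrix (Fin n) (Fin n) ℝ =>
      p.1.ofLp ⬝ᵥ p.2 *ᵥ p.1.ofLp := by fun_prop
  have hK : IsCompact (Metric.sphere (0 : EuclideanSpace ℝ (Fin n)) 1) := isCompact_sphere _ _
  obtain ⟨m, hm0, hm⟩ := hK.exists_forall_le'
    (f := fun v : EuclideanSpace ℝ (Fin n) => v.ofLp ⬝ᵥ Om *ᵥ v.ofLp) (a := 0)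
    (hcont.comp (Continuous.prodMk_left Om)).continuousOn fun v hv => by
      have hv0 : v.ofLp ≠ 0 := by
        intro h0
        have : v = 0 := by ext i; simp [h0]
        simp [this] at hv
      simpa using hOm.dotProduct_mulVec_pos hv0
  refine ⟨m / 2, by positivity, ?_⟩
  have hnhds : ∀ᶠ A in 𝓝 Om, ∀ v ∈ Metric.sphere (0 : EuclideanSpace ℝ (Fin n)) 1,
      m / 2 < v.ofLp ⬝ᵥ A *ᵥ v.ofLp := by
    refine hK.eventually_forall_of_forall_eventually fun v hv => ?_
    exact ((hcont.comp continuous_swap).tendsto (Om, v)).eventually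
      (lt_mem_nhds ((half_lt_self hm0).trans_le (hm v hv)))
  filter_upwards [hM.eventually hnhds] with k hk v
  rcases eq_or_ne (norm2 v) 0 with h0 | h0
  · have : v = 0 := by
      have := norm_eq_zero.1 h0
      simpa using this
    simp [this, norm2]
  · have hpos : 0 < norm2 v := lt_of_le_of_ne (norm2_nonneg v) h0.symm
    have := hk (WithLp.toLp 2 ((norm2 v)⁻¹ • v)) (by
      rw [mem_sphere_zero_iff_norm, WithLp.toLp_smul, norm_smul, norm_inv,
        Real.norm_of_nonneg hpos.le]
      exact inv_mul_cancel₀ h0)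
    simp only [Matrix.mulVec_smul, dotProduct_smul, smul_dotProduct, smul_eq_mul] at this
    have h2 : (norm2 v)⁻¹ * ((norm2 v)⁻¹ * (v ⬝ᵥ M k *ᵥ v)) =
        (v ⬝ᵥ M k *ᵥ v) / norm2 v ^ 2 := by field_simp
    rw [h2, lt_div_iff₀ (by positivity)] at this
    exact this.le

/-! ### Noise of diluted weights -/

section Noise

variable {Ω : Type*} [MeasurableSpace Ω] {P : Measure Ω} [IsProbabilityMeasure P]
  {eps : ℕ → ℤ → Ω → ℝ} {T₁ : ℕ} {J : ℕ → ℕ} {σ₀ : ℝ}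

lemma ShockAssumption.memLp_two (h : ShockAssumption P eps T₁ J σ₀) (i : ℕ) {t : ℤ} (ht : t ≤ T₁) :
    MemLp (eps i t) 2 P := by
  obtain ⟨C, hC⟩ := h.fourth_moment
  rw [memLp_two_iff_integrable_sq (h.measurable i t ht).aestronglyMeasurable]
  refine ((integrable_const (1 : ℝ)).add (hC i t ht).1).mono'
    ((h.measurable i t ht).pow_const 2).aestronglyMeasurable (Eventually.of_forall fun ω => ?_)
  rw [Real.norm_eq_abs, abs_of_nonneg (sq_nonneg _)]
  simp only [Pi.add_apply]
  nlinarith [sq_nonneg (eps i t ω ^ 2 - 1)]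

lemma ShockAssumption.integral_sq_le (h : ShockAssumption P eps T₁ J σ₀) :
    ∃ K : ℝ, 0 ≤ K ∧ ∀ i t, t ≤ (T₁ : ℤ) → ∫ ω, eps i t ω ^ 2 ∂P ≤ K := by
  obtain ⟨C, hC⟩ := h.fourth_moment
  have hK : ∀ i t, t ≤ (T₁ : ℤ) → ∫ ω, eps i t ω ^ 2 ∂P ≤ 1 + C := by
    intro i t ht
    calc ∫ ω, eps i t ω ^ 2 ∂P ≤ ∫ ω, (1 + eps i t ω ^ 4) ∂P := by
          refine integral_mono (h.memLp_two i ht).integrable_sq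
            ((integrable_const _).add (hC i t ht).1) fun ω => ?_
          nlinarith [sq_nonneg (eps i t ω ^ 2 - 1)]
      _ = 1 + ∫ ω, eps i t ω ^ 4 ∂P := by
          rw [integral_add (integrable_const _) (hC i t ht).1]
          simp
      _ ≤ 1 + C := by linarith [(hC i t ht).2]
  exact ⟨1 + C, (integral_nonneg fun _ => sq_nonneg _).trans (hK 0 0 (by positivity)), hK⟩

/-- By independence across units, the second moment of the weighted shocks is the weighted sum of
the second moments, with squared weights. -/
lemma ShockAssumption.integral_sq_sum (h : ShockAssumption P eps T₁ J σ₀) {t : ℤ} (ht : t ≤ T₁)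
    {n : ℕ} (w : Fin n → ℝ) :
    ∫ ω, (∑ j : Fin n, w j * eps (j + 1) t ω) ^ 2 ∂P =
      ∑ j : Fin n, w j ^ 2 * ∫ ω, eps (j + 1) t ω ^ 2 ∂P := by
  have hL : ∀ j : Fin n, MemLp (fun ω => w j * eps (j + 1) t ω) 2 P := fun j =>
    (h.memLp_two _ ht).const_mul _
  have hind : iIndepFun (fun i => eps i t) P :=
    h.indep.comp (fun _ x => x ⟨t, ht⟩) fun _ => measurable_pi_apply _
  have hvar := IndepFun.variance_sum (μ := P) (s := Finset.univ)
    (X := fun (j : Fin n) ω => w j * eps (j + 1) t ω) (fun j _ => hL j) (by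
      intro i _ j _ hij
      have hne : (i : ℕ) + 1 ≠ j + 1 := by
        intro hcon
        exact hij (Fin.ext (by omega))
      exact (hind.indepFun hne).comp (measurable_const_mul (w i)) (measurable_const_mul (w j)))
  have hfun : (∑ j : Fin n, fun ω => w j * eps (j + 1) t ω) =
      fun ω => ∑ j : Fin n, w j * eps (j + 1) t ω := by
    ext ω; simp
  have hmean : ∫ ω, ∑ j : Fin n, w j * eps (j + 1) t ω ∂P = 0 := by
    rw [integral_finsetSum _ fun j _ => (hL j).integrable (by norm_num)]
    simp [integral_const_mul, h.mean_zero _ t ht]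
  rw [hfun, variance_of_integral_eq_zero (memLp_finsetSum _ fun j _ => hL j).aemeasurable hmean]
    at hvar
  rw [hvar]
  refine Finset.sum_congr rfl fun j _ => ?_
  rw [variance_const_mul, variance_of_integral_eq_zero (h.memLp_two _ ht).aemeasurable
    (h.mean_zero _ t ht)]

/-- Weights with vanishing Euclidean norm average out the shocks of the controls. -/
lemma ShockAssumption.tendsto_noiseFit (h : ShockAssumption P eps T₁ J σ₀)
    {w : (T₀ : ℕ) → Fin (J T₀) → ℝ} (hw : Tendsto (fun T₀ => norm2 (w T₀)) atTop (𝓝 0)) :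
    TendstoInMeasure P (fun T₀ ω => noiseFit (fun i t => eps i t ω) T₀ (J T₀) (w T₀))
      atTop fun _ => 0 := by
  have hT : ∀ t : ℤ, t ≤ 0 → t ≤ (T₁ : ℤ) := fun t ht => ht.trans (by positivity)
  have hint : ∀ T₀ : ℕ, ∀ t ≤ 0,
      Integrable (fun ω => (∑ j : Fin (J T₀), w T₀ j * eps (j + 1) t ω) ^ 2) P := fun T₀ t ht =>
    (memLp_finsetSum _ fun j _ => (h.memLp_two _ (hT t ht)).const_mul (w T₀ j)).integrable_sq
  obtain ⟨K, hK0, hK⟩ := h.integral_sq_le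
  refine tendstoInMeasure_zero_of_integral (fun T₀ => integrable_preMean (hint T₀) T₀) ?_
  have hlim : Tendsto (fun T₀ => norm2 (w T₀) ^ 2 * K) atTop (𝓝 0) := by
    simpa using (hw.pow 2).mul_const K
  refine squeeze_zero (fun _ => integral_nonneg fun _ => abs_nonneg _) (fun T₀ => ?_) hlim
  simp only [abs_of_nonneg (noiseFit_nonneg _ _ _ _)]
  unfold noiseFit
  rw [integral_preMean (hint T₀)]
  refine (preMean_mono fun t ht => ?_).trans (preMean_const_le T₀ (by positivity))
  rw [h.integral_sq_sum (hT t ht), norm2_sq, Finset.sum_mul]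
  gcongr with j
  exact hK _ t (hT t ht)

/-- The average squared shock of the treated unit converges in probability to `σ₀²`. -/
lemma ShockAssumption.tendsto_preMean_sq (h : ShockAssumption P eps T₁ J σ₀) :
    TendstoInMeasure P (fun T₀ ω => |preMean T₀ (fun t => eps 0 t ω ^ 2) - σ₀ ^ 2|)
      atTop fun _ => 0 := by
  have hT : ∀ t : ℤ, t ≤ 0 → t ≤ (T₁ : ℤ) := fun t ht => ht.trans (by positivity)
  obtain ⟨C, hC⟩ := h.fourth_moment
  -- mixing of any one of the vector processes already gives mixing of its component `0`
  have hlln : MeanLLN P fun t ω => eps 0 t ω ^ 2 :=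
    MeanLLN.sq_of_mixing (X := fun t ω (i : Fin (J 0 + 1)) => eps i t ω)
      (fun t ht => measurable_pi_lambda _ fun i => h.measurable i t (hT t ht)) (h.mixing 0)
      (g := fun x => x 0) (measurable_pi_apply 0) (fun t ht => (hC 0 t (hT t ht)).1)
      (fun t ht => (hC 0 t (hT t ht)).2)
  have h1 := tendstoInMeasure_zero_of_integral (fun T₀ => (integrable_preMean_center hlln.1 T₀).abs)
    (by simpa only [abs_abs] using hlln.2)
  have h2 : Tendsto (fun T₀ : ℕ => |preMean T₀ (fun t => ∫ ω, eps 0 t ω ^ 2 ∂P) - σ₀ ^ 2|) atTop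
      (𝓝 0) := tendsto_iff_norm_sub_tendsto_zero.1 h.variance_limit
  refine tendstoInMeasure_zero_of_le
    (tendstoInMeasure_zero_add h1 (tendstoInMeasure_zero_of_tendsto h2))
    (Eventually.of_forall fun T₀ ω => ?_)
  rw [abs_abs, preMean_sub]
  exact abs_sub_le _ _ _

end Noise

end SyntheticControl

/-! ### Recovery of the loadings, the fit and the dilution of the weights -/

open SyntheticControl in
theorem proposition1 {Ω : Type*} [MeasurableSpace Ω] (P : Measure Ω) [IsProbabilityMeasure P]
    {F : ℕ} (T₁ : ℕ) (J : ℕ → ℕ) (hJ : ∀ T₀, 1 ≤ J T₀)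
    (lam : ℤ → Fin F → ℝ) (mu : ℕ → Fin F → ℝ)
    (eps : ℕ → ℤ → Ω → ℝ) (eff : ℕ → ℤ → Ω → ℝ) (σ₀ : ℝ)
    (what : (T₀ : ℕ) → Ω → Fin (J T₀) → ℝ)
    (hw : ∀ T₀ ω, SyntheticControl.IsSCWeights
      (fun i t => SyntheticControl.outcome lam mu eps eff i t ω) T₀ (J T₀) (what T₀ ω))
    (hshock : SyntheticControl.ShockAssumption P eps T₁ J σ₀)
    (hload : SyntheticControl.LoadingAssumption mu J)
    (hfactor : SyntheticControl.FactorAssumption lam)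
    (hcrossA : SyntheticControl.CrossMomentAssumptionA P lam eps J) :
    TendstoInMeasure P
      (fun T₀ ω => WithLp.toLp 2
        ((SyntheticControl.loadingMatrix mu (J T₀))ᵀ *ᵥ what T₀ ω))
      atTop (fun _ => WithLp.toLp 2 (mu 0)) ∧
    TendstoInMeasure P
      (fun T₀ ω => SyntheticControl.preFit
        (fun i t => SyntheticControl.outcome lam mu eps eff i t ω) T₀ (J T₀) (what T₀ ω))
      atTop (fun _ => σ₀ ^ 2) ∧
    (SyntheticControl.CrossMomentAssumptionB P eps J →
      TendstoInMeasure P (fun T₀ ω => SyntheticControl.norm2 (what T₀ ω))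
        atTop (fun _ => 0)) := by
  obtain ⟨wstar, hstar, hgap, hdil⟩ := hload.diluted
  obtain ⟨C, hC⟩ := hload.bounded
  obtain ⟨Om, hOm, hlim⟩ := hfactor
  obtain ⟨κ, hκ, hcoer⟩ := eventually_coercive hOm hlim
  have hy : ∀ ω i, ∀ t ≤ (0 : ℤ), outcome lam mu eps eff i t ω = lam t ⬝ᵥ mu i + eps i t ω := by
    intro ω i t ht
    simp [outcome, treat, outcomeN, ht.not_gt]
  -- the cross terms
  let R : ℕ → Ω → ℝ := fun T₀ ω => crossBound lam (fun i t => eps i t ω) T₀ (J T₀) (2 * C)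
  have hR : TendstoInMeasure P R atTop fun _ => 0 :=
    tendstoInMeasure_zero_add
      (tendstoInMeasure_zero_const_mul _ (tendstoInMeasure_zero_sum _ fun f _ => hcrossA.factor f))
      (tendstoInMeasure_zero_const_mul _ hcrossA.treated)
  -- the excess fit of the competitor `w*`, which bounds that of the estimator
  let E : ℕ → Ω → ℝ := fun T₀ ω => factorFit lam T₀ (loadingGap mu (J T₀) (wstar T₀)) +
    noiseFit (fun i t => eps i t ω) T₀ (J T₀) (wstar T₀) + 2 * R T₀ ω
  have hgap0 : Tendsto (fun T₀ => loadingGap mu (J T₀) (wstar T₀)) atTop (𝓝 0) := by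
    rw [tendsto_pi_nhds]
    refine fun f => squeeze_zero_norm (fun T₀ => ?_) hgap
    refine (Eq.le ?_).trans (abs_apply_le_norm2 _ f)
    rw [Real.norm_eq_abs, loadingGap, Pi.sub_apply, Pi.sub_apply, abs_sub_comm]
  have hG : Tendsto (fun T₀ => factorFit lam T₀ (loadingGap mu (J T₀) (wstar T₀))) atTop
      (𝓝 0) := by
    have hcont : Continuous fun p : (Fin F → ℝ) × Matrix (Fin F) (Fin F) ℝ =>
        p.1 ⬝ᵥ p.2 *ᵥ p.1 := by fun_prop
    have := (hcont.tendsto (0, Om)).comp (hgap0.prodMk_nhds hlim)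
    simpa [Function.comp_def, factorFit_eq_dotProduct_mulVec] using this
  have hE : TendstoInMeasure P E atTop fun _ => 0 :=
    tendstoInMeasure_zero_add
      (tendstoInMeasure_zero_add (tendstoInMeasure_zero_of_tendsto hG)
        (hshock.tendsto_noiseFit hdil))
      (tendstoInMeasure_zero_const_mul 2 hR)
  have hopt : ∀ T₀ ω, factorFit lam T₀ (loadingGap mu (J T₀) (what T₀ ω)) +
      noiseFit (fun i t => eps i t ω) T₀ (J T₀) (what T₀ ω) ≤ E T₀ ω := fun T₀ ω =>
    (hw T₀ ω).factorFit_add_noiseFit_le (hy ω) hC (hstar T₀)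
  refine ⟨?_, ?_, fun hcrossB => ?_⟩
  · have h0 : TendstoInMeasure P (fun T₀ ω => norm2 (loadingGap mu (J T₀) (what T₀ ω))) atTop
        fun _ => 0 := by
      refine tendstoInMeasure_zero_of_sq_le hκ hE ?_
      filter_upwards [hcoer] with T₀ hT ω
      have h1 := hT (loadingGap mu (J T₀) (what T₀ ω))
      rw [← factorFit_eq_dotProduct_mulVec] at h1
      linarith [hopt T₀ ω, noiseFit_nonneg (fun i t => eps i t ω) T₀ (J T₀) (what T₀ ω)]
    rw [tendstoInMeasure_iff_norm] at h0 ⊢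
    intro ε hε
    have := h0 ε hε
    simp only [sub_zero, norm2, norm_norm, loadingGap, WithLp.toLp_sub] at this
    simpa only [norm_sub_rev] using this
  · have h0 : TendstoInMeasure P (fun T₀ ω => preFit (fun i t => outcome lam mu eps eff i t ω) T₀
        (J T₀) (what T₀ ω) - σ₀ ^ 2) atTop fun _ => 0 := by
      refine tendstoInMeasure_zero_of_le (tendstoInMeasure_zero_add
        (tendstoInMeasure_zero_add hR hE) hshock.tendsto_preMean_sq)
        (Eventually.of_forall fun T₀ ω => ?_)
      have h1 := abs_le.1 (abs_preFit_sub_le (T₀ := T₀) (hy ω) (hw T₀ ω).1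
        (abs_loadingGap_le hC (hw T₀ ω).1))
      have h2 := hopt T₀ ω
      have h3 := factorFit_nonneg lam T₀ (loadingGap mu (J T₀) (what T₀ ω))
      have h4 := noiseFit_nonneg (fun i t => eps i t ω) T₀ (J T₀) (what T₀ ω)
      have h5 := le_abs_self (preMean T₀ (fun t => eps 0 t ω ^ 2) - σ₀ ^ 2)
      have h6 := neg_abs_le (preMean T₀ (fun t => eps 0 t ω ^ 2) - σ₀ ^ 2)
      simp only [R]
      rw [abs_le]
      constructor <;> linarith [h1.1, h1.2]
    rw [tendstoInMeasure_iff_norm] at h0 ⊢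
    simpa only [sub_zero] using h0
  · obtain ⟨c, hc, hlow⟩ := hcrossB.lower
    let L : ℕ → Set Ω := fun T₀ =>
      {ω | c * T₀ ≤ ⨅ j : Fin (J T₀), ∑ t ∈ prePeriods T₀, |eps (j + 1) t ω ^ 2|}
    have hLm : ∀ T₀, MeasurableSet (L T₀) := by
      intro T₀
      refine measurableSet_le measurable_const (Measurable.iInf fun j => ?_)
      refine Finset.measurable_fun_sum _ fun t ht => ?_
      have hm := hshock.measurable (j + 1) t ((mem_prePeriods.1 ht).2.trans (by positivity))
      exact (hm.pow_const 2).norm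
    -- off the event `L` the trivial bound `‖w‖ ≤ 1` is used
    have hV : TendstoInMeasure P (fun T₀ => (L T₀)ᶜ.indicator fun _ => c) atTop fun _ => 0 := by
      rw [tendstoInMeasure_iff_norm]
      intro ε hε
      have hcompl : Tendsto (fun T₀ => P (L T₀)ᶜ) atTop (𝓝 0) := by
        simp only [prob_compl_eq_one_sub (hLm _)]
        simpa only [tsub_self] using
          ENNReal.Tendsto.sub tendsto_const_nhds hlow (Or.inl ENNReal.one_ne_top)
      refine tendsto_of_tendsto_of_tendsto_of_le_of_le tendsto_const_nhds hcompl
        (fun _ => zero_le) fun T₀ => measure_mono fun ω hω => ?_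
      by_contra hcon
      simp only [sub_zero, Set.mem_ofPred_eq, Set.indicator_of_notMem hcon, norm_zero] at hω
      exact hω.not_gt hε
    refine tendstoInMeasure_zero_of_sq_le hc
      (tendstoInMeasure_zero_add (tendstoInMeasure_zero_add hE hcrossB.cross) hV) ?_
    filter_upwards [eventually_gt_atTop 0] with T₀ hT ω
    have hT' : (0 : ℝ) < T₀ := by exact_mod_cast hT
    have hU0 : 0 ≤ ⨆ p : {p : Fin (J T₀) × Fin (J T₀) // p.1 ≠ p.2},
        |preMean T₀ fun t => eps (p.1.1 + 1) t ω * eps (p.1.2 + 1) t ω| :=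
      Real.iSup_nonneg fun _ => abs_nonneg _
    have hE0 : noiseFit (fun i t => eps i t ω) T₀ (J T₀) (what T₀ ω) ≤ E T₀ ω := by
      linarith [hopt T₀ ω, factorFit_nonneg lam T₀ (loadingGap mu (J T₀) (what T₀ ω))]
    by_cases hω : ω ∈ L T₀
    · rw [Set.indicator_of_notMem (by simpa using hω), add_zero]
      refine (norm2_sq_le_noiseFit (e := fun i t => eps i t ω) (T₀ := T₀) (hw T₀ ω).1
        (fun j => ?_) hU0 fun i j hij => ?_).trans (by linarith)
      · have h1 : c * T₀ ≤ ∑ t ∈ prePeriods T₀, |eps (j + 1) t ω ^ 2| :=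
          le_trans hω (ciInf_le (Set.finite_range _).bddBelow j)
        simp only [abs_sq] at h1
        rw [preMean, inv_mul_eq_div, le_div_iff₀ hT']
        exact h1
      · exact le_iSup_fin (fun p : {p : Fin (J T₀) × Fin (J T₀) // p.1 ≠ p.2} =>
          |preMean T₀ fun t => eps (p.1.1 + 1) t ω * eps (p.1.2 + 1) t ω|) ⟨(i, j), hij⟩
    · rw [Set.indicator_of_mem hω]
      have := noiseFit_nonneg (fun i t => eps i t ω) T₀ (J T₀) (what T₀ ω)
      nlinarith [norm2_sq_le_one (hw T₀ ω).1]
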